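/- Let $S^1=\mathbb R/\mathbb Z$, written additively, and let $L\mathbb R=C^\infty(S^1,\mathbb R)$ with its usual Fréchet topology, that of uniform convergence on $S^1$ of the derivatives of every order. For $t\in S^1$ let $R_t\colon L\mathbb R\to L\mathbb R$ be the continuous linear map $(R_t\gamma)(s)=\gamma(s+t)$, and let $\mathcal L_b(L\mathbb R)$ be the space of continuous linear maps $L\mathbb R\to L\mathbb R$ with the topology of uniform convergence on bounded sets. Smoothness is meant in the convenient calculus: a curve $c\colon\mathbb R\to E$ in a locally convex space $E$ is smooth if all its iterated derivatives exist (as limits of difference quotients in $E$); a curve in $S^1$ is smooth if it is locally the image of a smooth real-valued function under $\mathbb R\to\mathbb R/\mathbb Z$; a curve in a product is smooth if its components are; and a map is smooth if it takes smooth curves to smooth curves. Then: 1. the action map $\rho\colon S^1\times L\mathbb R\to L\mathbb R$, $\rho(t,\gamma)=R_t\gamma$, is smooth; 2. the representation map $S^1\to\mathcal L_b(L\mathbb R)$, $t\mapsto R_t$, is smooth. -/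

import Mathlib

open Filter Topology
open scoped ContDiff

noncomputable section

namespace LoopSpace

/-- The circle `S¹ = ℝ / ℤ`, written additively. -/
abbrev S1 : Type := AddCircle (1 : ℝ)

/-- The smooth functions on `S¹ = ℝ / ℤ`. As `ℝ → ℝ / ℤ` is a surjective local diffeomorphism,
`γ` is smooth if and only if its pullback to `ℝ` is smooth. -/
def smoothLoops : Submodule ℝ (S1 → ℝ) where
  carrier := {γ | ContDiff ℝ ∞ fun x : ℝ => γ (x : S1)}
  add_mem' {a b} ha hb := by
    have ha' : ContDiff ℝ ∞ fun x : ℝ => a (x : S1) := ha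
    have hb' : ContDiff ℝ ∞ fun x : ℝ => b (x : S1) := hb
    exact ha'.add hb'
  zero_mem' := (contDiff_const : ContDiff ℝ ∞ fun _ : ℝ => (0 : ℝ))
  smul_mem' r a ha := by
    have ha' : ContDiff ℝ ∞ fun x : ℝ => a (x : S1) := ha
    exact ha'.const_smul r

/-- The space `L ℝ = C^∞(S¹, ℝ)` of smooth loops. It is a type synonym, so that it does not inherit
the topology of pointwise convergence. -/
def LR : Type := smoothLoops

namespace LR

instance : AddCommGroup LR := inferInstanceAs (AddCommGroup smoothLoops)

instance : Module ℝ LR := inferInstanceAs (Module ℝ smoothLoops)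

instance : FunLike LR S1 ℝ where
  coe γ := γ.1
  coe_injective := Subtype.val_injective

/-- The 1-periodic function on `ℝ` given by a loop. -/
def pull (γ : LR) : ℝ → ℝ := fun x => γ (x : S1)

theorem contDiff_pull (γ : LR) : ContDiff ℝ ∞ γ.pull := γ.2

theorem periodic_iteratedDeriv (γ : LR) (k : ℕ) :
    Function.Periodic (iteratedDeriv k γ.pull) 1 := by
  intro x
  have h : (fun z => γ.pull (z + 1)) = γ.pull := by
    funext z
    simp [pull]
  have h2 := congrFun (iteratedDeriv_comp_add_const k γ.pull (1 : ℝ)) x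
  rw [h] at h2
  exact h2.symm

/-- The `k`-th derivative `γ^{(k)}` of a smooth loop, as a continuous function on `S¹`:
`iterDeriv k γ (x mod ℤ)` is the `k`-th derivative at `x` of the pullback of `γ` to `ℝ`. -/
def iterDeriv (k : ℕ) : LR →ₗ[ℝ] C(S1, ℝ) where
  toFun γ :=
    { toFun := (γ.periodic_iteratedDeriv k).lift
      continuous_toFun := Continuous.quotient_lift
        (γ.contDiff_pull.continuous_iteratedDeriv k (by exact_mod_cast le_top)) _ }
  map_add' γ δ := by
    ext s
    induction s using QuotientAddGroup.induction_on with
    | H x =>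
      exact iteratedDeriv_fun_add (γ.contDiff_pull.contDiffAt.of_le (by exact_mod_cast le_top))
        (δ.contDiff_pull.contDiffAt.of_le (by exact_mod_cast le_top))
  map_smul' r γ := by
    ext s
    induction s using QuotientAddGroup.induction_on with
    | H x => exact iteratedDeriv_const_smul_field r γ.pull

/-- All derivatives of a smooth loop at once. -/
def jet : LR →ₗ[ℝ] (ℕ → C(S1, ℝ)) := LinearMap.pi iterDeriv

/-- The usual Fréchet topology of `C^∞(S¹, ℝ)`: uniform convergence on `S¹` of the derivatives of
every order. (`C(S¹, ℝ)` carries the sup norm and `ℕ → C(S¹, ℝ)` the product topology.) -/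
instance : TopologicalSpace LR := TopologicalSpace.induced jet inferInstance

instance : IsTopologicalAddGroup LR := topologicalAddGroup_induced jet

instance : ContinuousSMul ℝ LR := continuousSMul_induced jet

/-- The rotated loop `R_t γ = (s ↦ γ (s + t))`. -/
def rotate (t : S1) (γ : LR) : LR :=
  ⟨fun s => γ (s + t), by
    induction t using QuotientAddGroup.induction_on with
    | H a => exact γ.contDiff_pull.comp (contDiff_id.add contDiff_const)⟩

theorem iterDeriv_rotate (k : ℕ) (t : S1) (γ : LR) :
    iterDeriv k (rotate t γ) = (iterDeriv k γ).comp (ContinuousMap.addRight t) := by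
  ext s
  induction t using QuotientAddGroup.induction_on with
  | H a =>
    induction s using QuotientAddGroup.induction_on with
    | H x => exact congrFun (iteratedDeriv_comp_add_const k γ.pull a) x

theorem continuous_rotate (t : S1) : Continuous (rotate t) := by
  refine continuous_induced_rng.2 (continuous_pi fun k => ?_)
  have h : (fun γ : LR => (jet (rotate t γ)) k) =
      (fun f : C(S1, ℝ) => f.comp (ContinuousMap.addRight t)) ∘ fun γ => jet γ k :=
    funext fun γ => iterDeriv_rotate k t γ
  refine (h ▸ ?_ : Continuous fun γ : LR => (jet (rotate t γ)) k)
  exact (ContinuousMap.continuous_precomp _).comp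
    ((continuous_apply k).comp continuous_induced_dom)

/-- The action map `ρ : S¹ × L ℝ → L ℝ`. -/
def actionMap (p : S1 × LR) : LR := rotate p.1 p.2

/-- The representation map `t ↦ R_t` from `S¹` to the space of continuous linear endomorphisms of
`L ℝ`. Mathlib's topology on `LR →L[ℝ] LR` is that of uniform convergence on bounded sets, so that
this space is `L_b(L ℝ)`. -/
def representation (t : S1) : LR →L[ℝ] LR where
  toFun := rotate t
  map_add' _ _ := rfl
  map_smul' _ _ := rfl
  cont := continuous_rotate t

end LR

/-- The smooth curves in a locally convex space: those of which all iterated derivatives exist,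
as limits of difference quotients in the topology of `E`. -/
def smoothCurves (E : Type*) [AddCommGroup E] [Module ℝ E] [TopologicalSpace E] : Set (ℝ → E) :=
  {c | ∃ d : ℕ → ℝ → E, d 0 = c ∧ ∀ (n : ℕ) (t : ℝ),
    Tendsto (fun h : ℝ => h⁻¹ • (d n (t + h) - d n t)) (𝓝[≠] 0) (𝓝 (d (n + 1) t))}

/-- The smooth curves in `S¹ = ℝ / ℤ`: those that locally lift to smooth functions
`ℝ → ℝ`, the charts of `S¹` being the local inverses of the projection `ℝ → ℝ / ℤ`. -/
def smoothCurvesCircle : Set (ℝ → S1) :=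
  {c | ∀ t₀ : ℝ, ∃ θ : ℝ → ℝ, ContDiff ℝ ∞ θ ∧ ∀ᶠ t in 𝓝 t₀, c t = (θ t : S1)}

/-- The smooth curves in a product: those with smooth components. -/
def smoothCurvesProd {X Y : Type*} (CX : Set (ℝ → X)) (CY : Set (ℝ → Y)) : Set (ℝ → X × Y) :=
  {c | (fun t => (c t).1) ∈ CX ∧ (fun t => (c t).2) ∈ CY}

/-- Smoothness in the convenient calculus of a map between spaces with given smooth curves: the map
takes smooth curves to smooth curves. -/
def ConvenientSmooth {X Y : Type*} (CX : Set (ℝ → X)) (CY : Set (ℝ → Y)) (f : X → Y) : Prop :=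
  ∀ c ∈ CX, (fun t => f (c t)) ∈ CY

end LoopSpace

end

/-!
A smooth curve in `ℝ / ℤ` has a global smooth lift `θ : ℝ → ℝ` (`exists_contDiff_lift`), so both
claims concern the one-parameter group `a ↦ R_a`, `a : ℝ`, along a smooth function `θ`. Write `D`
for the derivative of loops, a continuous operator on `L ℝ`.

The analytic input is that `a ↦ R_a` is differentiable for the topology of uniform convergence on
bounded sets, with derivative `R_a ∘ D` (`hasCurveDerivAt_representation`): by Taylor's formula,
the `k`-th derivative of `h⁻¹ (R_{a+h} γ - R_a γ) - R_a D γ` is bounded by `|h| ‖γ^{(k+2)}‖`, and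
`‖γ^{(k+2)}‖` is bounded on bounded sets of loops.

Smoothness then follows from a coinductive principle: a set of curves, each of which has a
derivative in the set, consists of smooth curves (`mem_smoothCurves_of_forall_exists_deriv`).
* For the representation, the set is the span of the curves `f • (R_θ ∘ Dⁿ)` with `f` smooth, since
  `(R_θ ∘ Dⁿ)' = θ' • (R_θ ∘ Dⁿ⁺¹)`.
* For the action, it is the set of the curves `R_θ c` with `c` smooth in `L ℝ`, since
  `(R_θ c)' = R_θ (c' + θ' • D c)`. This product rule rests on the joint continuity of the action,
  which
  is that of composition in the compact-open topology, applied to every derivative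
  (`continuous_actionMap`).
-/

open Filter Topology
open scoped ContDiff

noncomputable section

namespace LoopSpace

/-! ### Derivatives of curves in topological vector spaces -/

section Curves

variable {E F : Type*} [AddCommGroup E] [Module ℝ E] [TopologicalSpace E]
  [AddCommGroup F] [Module ℝ F] [TopologicalSpace F]

/-- The curve `c` has derivative `v` at `t`, as a limit of difference quotients. -/
def HasCurveDerivAt (c : ℝ → E) (v : E) (t : ℝ) : Prop :=
  Tendsto (fun h : ℝ => h⁻¹ • (c (t + h) - c t)) (𝓝[≠] 0) (𝓝 v)

/-- Coinductive criterion for smoothness: if every curve of `S` has a derivative that is again in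
`S`, then the curves of `S` are smooth. -/
theorem mem_smoothCurves_of_forall_exists_deriv {S : Set (ℝ → E)}
    (hS : ∀ c ∈ S, ∃ c' ∈ S, ∀ t, HasCurveDerivAt c (c' t) t) {c : ℝ → E} (hc : c ∈ S) :
    c ∈ smoothCurves E := by
  choose! D hD hder using hS
  have hmem : ∀ n, D^[n] c ∈ S := fun n => by
    induction n with
    | zero => exact hc
    | succ n ih => rw [Function.iterate_succ_apply']; exact hD _ ih
  refine ⟨fun n => D^[n] c, rfl, fun n t => ?_⟩
  beta_reduce
  rw [Function.iterate_succ_apply']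
  exact hder _ (hmem n) t

theorem exists_deriv_of_mem_smoothCurves {c : ℝ → E} (hc : c ∈ smoothCurves E) :
    ∃ c' ∈ smoothCurves E, ∀ t, HasCurveDerivAt c (c' t) t := by
  obtain ⟨d, rfl, hd⟩ := hc
  exact ⟨d 1, ⟨fun n => d (n + 1), rfl, fun n => hd (n + 1)⟩, hd 0⟩

theorem hasCurveDerivAt_real_iff {f : ℝ → ℝ} {v t : ℝ} :
    HasCurveDerivAt f v t ↔ HasDerivAt f v t :=
  hasDerivAt_iff_tendsto_slope_zero.symm

theorem HasCurveDerivAt.clm_comp {c : ℝ → E} {v : E} {t : ℝ} (hc : HasCurveDerivAt c v t)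
    (L : E →L[ℝ] F) : HasCurveDerivAt (fun s => L (c s)) (L v) t := by
  refine ((L.continuous.tendsto v).comp hc).congr fun h => ?_
  simp

theorem HasCurveDerivAt.add [IsTopologicalAddGroup E] {c d : ℝ → E} {v w : E} {t : ℝ}
    (hc : HasCurveDerivAt c v t) (hd : HasCurveDerivAt d w t) :
    HasCurveDerivAt (c + d) (v + w) t := by
  refine (Tendsto.add hc hd).congr fun h => ?_
  rw [← smul_add, Pi.add_apply, Pi.add_apply, add_sub_add_comm]

theorem add_mem_smoothCurves [IsTopologicalAddGroup E] {c d : ℝ → E}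
    (hc : c ∈ smoothCurves E) (hd : d ∈ smoothCurves E) :
    (fun t => c t + d t) ∈ smoothCurves E := by
  obtain ⟨c, rfl, hc⟩ := hc
  obtain ⟨d, rfl, hd⟩ := hd
  exact ⟨fun n => c n + d n, rfl, fun n t => HasCurveDerivAt.add (hc n t) (hd n t)⟩

theorem clm_comp_mem_smoothCurves (L : E →L[ℝ] F) {c : ℝ → E} (hc : c ∈ smoothCurves E) :
    (fun t => L (c t)) ∈ smoothCurves F := by
  obtain ⟨d, rfl, hd⟩ := hc
  exact ⟨fun n t => L (d n t), rfl, fun n t => HasCurveDerivAt.clm_comp (hd n t) L⟩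

theorem HasCurveDerivAt.tendsto [IsTopologicalAddGroup E] [ContinuousSMul ℝ E]
    {c : ℝ → E} {v : E} {t : ℝ} (hc : HasCurveDerivAt c v t) :
    Tendsto (fun h => c (t + h)) (𝓝[≠] 0) (𝓝 (c t)) := by
  have h0 : Tendsto (fun h : ℝ => h) (𝓝[≠] 0) (𝓝 0) := nhdsWithin_le_nhds
  have h1 := (h0.smul hc).const_add (c t)
  rw [zero_smul, add_zero] at h1
  refine h1.congr' ?_
  filter_upwards [self_mem_nhdsWithin] with h hh
  rw [smul_inv_smul₀ hh, add_sub_cancel]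

theorem HasCurveDerivAt.smul [IsTopologicalAddGroup E] [ContinuousSMul ℝ E]
    {f : ℝ → ℝ} {c : ℝ → E} {f' : ℝ} {v : E} {t : ℝ}
    (hf : HasDerivAt f f' t) (hc : HasCurveDerivAt c v t) :
    HasCurveDerivAt (fun s => f s • c s) (f' • c t + f t • v) t := by
  refine ((Tendsto.smul (hasCurveDerivAt_real_iff.2 hf) hc.tendsto).add
    (Tendsto.const_smul hc (f t))).congr
    fun h => ?_
  simp only [smul_eq_mul]
  module

theorem HasCurveDerivAt.comp [ContinuousSMul ℝ E] {c : ℝ → E} {θ : ℝ → ℝ} {θ' : ℝ} {v : E} {t : ℝ}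
    (hc : HasCurveDerivAt c v (θ t)) (hθ : HasDerivAt θ θ' t) :
    HasCurveDerivAt (fun s => c (θ s)) (θ' • v) t := by
  -- The difference quotient of `c` at `θ t`, extended continuously to `0`: the increment
  -- `θ (t + h) - θ t` may vanish for `h ≠ 0`.
  set q : ℝ → E := Function.update (fun s => s⁻¹ • (c (θ t + s) - c (θ t))) 0 v with hq
  have hq0 : q 0 = v := Function.update_self ..
  have hqc : ContinuousAt q 0 := continuousAt_update_same.2 hc
  have hq_smul : ∀ s, c (θ t + s) - c (θ t) = s • q s := fun s => by
    rcases eq_or_ne s 0 with rfl | hs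
    · simp
    · rw [hq, Function.update_of_ne hs, smul_inv_smul₀ hs]
  have hθ' := hasCurveDerivAt_real_iff.2 hθ
  have hinc : Tendsto (fun h => θ (t + h) - θ t) (𝓝[≠] 0) (𝓝 0) := by
    simpa using hθ'.tendsto.sub_const (θ t)
  have hlim := Tendsto.smul hθ' (hqc.tendsto.comp hinc)
  rw [hq0] at hlim
  refine hlim.congr fun h => ?_
  have := hq_smul (θ (t + h) - θ t)
  rw [add_sub_cancel] at this
  rw [this, Function.comp_apply, smul_eq_mul, mul_smul]

/-- If `uₙ' = g • uₙ₊₁` with `g` smooth, then the span of the curves `f • uₙ`, `f` smooth, is closed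
under derivatives, so it consists of smooth curves. -/
theorem smul_mem_smoothCurves_of_hasCurveDerivAt_succ [IsTopologicalAddGroup E] [ContinuousSMul ℝ E]
    {u : ℕ → ℝ → E} {g f : ℝ → ℝ}
    (hg : ContDiff ℝ ∞ g) (hu : ∀ n t, HasCurveDerivAt (u n) (g t • u (n + 1) t) t)
    (hf : ContDiff ℝ ∞ f) (n : ℕ) : (fun t => f t • u n t) ∈ smoothCurves E := by
  let B : Set (ℝ → E) := {c | ∃ f : ℝ → ℝ, ContDiff ℝ ∞ f ∧ ∃ n, c = fun t => f t • u n t}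
  let S : Submodule ℝ (ℝ → E) := Submodule.span ℝ B
  have hsub : B ⊆ S := Submodule.subset_span
  refine mem_smoothCurves_of_forall_exists_deriv (S := S) (fun c hc => ?_) (hsub ⟨f, hf, n, rfl⟩)
  induction hc using Submodule.span_induction with
  | mem c hc =>
    obtain ⟨f, hf, n, rfl⟩ := hc
    have hf' : ContDiff ℝ ∞ (deriv f) := (contDiff_infty_iff_deriv.1 hf).2
    refine ⟨(fun t => deriv f t • u n t) + fun t => (f t * g t) • u (n + 1) t,
      S.add_mem (hsub ⟨_, hf', n, rfl⟩) (hsub ⟨_, hf.mul hg, n + 1, rfl⟩), fun t => ?_⟩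
    have h := HasCurveDerivAt.smul ((hf.differentiable (by simp)) t).hasDerivAt (hu n t)
    rwa [smul_smul] at h
  | zero => exact ⟨0, S.zero_mem, fun t => by simp [HasCurveDerivAt, tendsto_const_nhds]⟩
  | add a b _ _ iha ihb =>
    obtain ⟨a', ha', ha⟩ := iha
    obtain ⟨b', hb', hb⟩ := ihb
    exact ⟨a' + b', S.add_mem ha' hb', fun t => (ha t).add (hb t)⟩
  | smul r a _ iha =>
    obtain ⟨a', ha', ha⟩ := iha
    exact ⟨r • a', S.smul_mem r ha', fun t =>
      (ha t).clm_comp (r • ContinuousLinearMap.id ℝ E)⟩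

theorem smul_mem_smoothCurves [IsTopologicalAddGroup E] [ContinuousSMul ℝ E]
    {f : ℝ → ℝ} (hf : ContDiff ℝ ∞ f) {c : ℝ → E}
    (hc : c ∈ smoothCurves E) : (fun t => f t • c t) ∈ smoothCurves E := by
  obtain ⟨d, rfl, hd⟩ := hc
  exact smul_mem_smoothCurves_of_hasCurveDerivAt_succ (g := fun _ => 1) contDiff_const
    (fun n t => by rw [one_smul]; exact hd n t) hf 0

end Curves

/-! ### Lifting curves from the circle to the line -/

/-- A smooth curve in `ℝ / ℤ` has a global smooth lift: its continuous lift along the covering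
`ℝ → ℝ / ℤ` differs from the local smooth lifts by locally constant integers. -/
theorem exists_contDiff_lift {c : ℝ → S1} (hc : c ∈ smoothCurvesCircle) :
    ∃ θ : ℝ → ℝ, ContDiff ℝ ∞ θ ∧ c = fun t => (θ t : S1) := by
  have hcont : Continuous c := continuous_iff_continuousAt.2 fun t => by
    obtain ⟨θ, hθ, h⟩ := hc t
    exact ((AddCircle.continuous_mk' 1).comp hθ.continuous).continuousAt.congr
      (h.mono fun _ hs => hs.symm)
  obtain ⟨e, he⟩ := QuotientAddGroup.mk_surjective (c 0)
  obtain ⟨Θ, ⟨-, hΘ⟩, -⟩ := (AddCircle.isCoveringMap_coe (1 : ℝ)).existsUnique_continuousMap_lifts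
    ⟨c, hcont⟩ 0 e he
  have hΘ' : ∀ t, (Θ t : S1) = c t := fun t => congrFun hΘ t
  refine ⟨Θ, contDiff_iff_contDiffAt.2 fun t => ?_, funext fun t => (hΘ' t).symm⟩
  obtain ⟨θ, hθ, h⟩ := hc t
  have hint : ∀ s, c s = (θ s : S1) → ∃ n : ℤ, Θ s - θ s = n := fun s hs => by
    have h0 : ((Θ s - θ s : ℝ) : S1) = 0 := by
      rw [AddCircle.coe_sub, hΘ', hs, sub_self]
    obtain ⟨n, hn⟩ := (AddCircle.coe_eq_zero_iff 1).1 h0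
    exact ⟨n, by simpa using hn.symm⟩
  obtain ⟨m, hm⟩ := hint t h.self_of_nhds
  have hdiff : ContinuousAt (fun s => Θ s - θ s) t :=
    (Θ.continuous.sub hθ.continuous).continuousAt
  have hclose := Metric.tendsto_nhds.1 hdiff 1 one_pos
  refine (hθ.add contDiff_const : ContDiff ℝ ∞ fun s => θ s + m).contDiffAt.congr_of_eventuallyEq ?_
  filter_upwards [h, hclose] with s hs hs1
  obtain ⟨n, hn⟩ := hint s hs
  rw [hn, hm, Real.dist_eq] at hs1
  have hnm : n = m := by
    have : |n - m| < 1 := by exact_mod_cast hs1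
    exact sub_eq_zero.1 (Int.abs_lt_one_iff.1 this)
  rw [← hnm, ← hn, add_sub_cancel]

namespace LR

/-! ### The Fréchet topology of the loop space -/

theorem continuous_iterDeriv (k : ℕ) : Continuous (iterDeriv k) :=
  (continuous_apply k).comp (continuous_induced_dom : Continuous jet)

theorem continuous_iff_iterDeriv {X : Type*} [TopologicalSpace X] {f : X → LR} :
    Continuous f ↔ ∀ k, Continuous fun x => iterDeriv k (f x) :=
  continuous_induced_rng.trans continuous_pi_iff

theorem tendsto_nhds_zero_iff {X : Type*} {l : Filter X} {f : X → LR} :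
    Tendsto f l (𝓝 0) ↔ ∀ k, Tendsto (fun x => iterDeriv k (f x)) l (𝓝 0) := by
  rw [nhds_induced, tendsto_comap_iff, map_zero, tendsto_pi_nhds]
  rfl

/-- Convergence to zero in `L_b(L ℝ)` means uniform convergence to zero, on bounded sets, of the
derivatives of every order of the values. -/
theorem tendsto_clm_nhds_zero {X : Type*} {l : Filter X} {A : X → LR →L[ℝ] LR}
    (h : ∀ S : Set LR, Bornology.IsVonNBounded ℝ S → ∀ k,
      Tendsto (fun p : X × LR => iterDeriv k (A p.1 p.2)) (l ×ˢ 𝓟 S) (𝓝 0)) :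
    Tendsto A l (𝓝 0) := by
  refine ContinuousLinearMap.hasBasis_nhds_zero.tendsto_right_iff.2 fun p hp => ?_
  exact eventually_prod_principal_iff.1 ((tendsto_nhds_zero_iff.2 (h p.1 hp.1)).eventually hp.2)

theorem exists_norm_iterDeriv_le {S : Set LR} (hS : Bornology.IsVonNBounded ℝ S) (k : ℕ) :
    ∃ C, ∀ γ ∈ S, ‖iterDeriv k γ‖ ≤ C := by
  let L : LR →L[ℝ] C(S1, ℝ) := ⟨iterDeriv k, continuous_iterDeriv k⟩
  have h := NormedSpace.isVonNBounded_iff ℝ |>.1 (hS.image L)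
  obtain ⟨C, hC⟩ := isBounded_iff_forall_norm_le.1 h
  exact ⟨C, fun γ hγ => hC _ ⟨γ, hγ, rfl⟩⟩

theorem continuous_actionMap : Continuous actionMap := by
  refine continuous_iff_iterDeriv.2 fun k => ?_
  have hadd : Continuous fun t : S1 => ContinuousMap.addRight t :=
    ContinuousMap.continuous_of_continuous_uncurry _ (continuous_snd.add continuous_fst)
  have h : (fun p : S1 × LR => iterDeriv k (actionMap p)) =
      fun p => (iterDeriv k p.2).comp (ContinuousMap.addRight p.1) :=
    funext fun p => iterDeriv_rotate k p.1 p.2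
  rw [h]
  exact ((continuous_iterDeriv k).comp continuous_snd).compCM (hadd.comp continuous_fst)

/-! ### Differentiation of loops -/

/-- The derivative of a loop, as an operator on `L ℝ`. It is the infinitesimal generator of the
rotation action. -/
def derivative : LR →L[ℝ] LR where
  toFun γ := ⟨iterDeriv 1 γ, by
    change ContDiff ℝ ∞ (iteratedDeriv 1 γ.pull)
    rw [iteratedDeriv_one]
    exact (contDiff_infty_iff_deriv.1 γ.contDiff_pull).2⟩
  map_add' γ δ := DFunLike.ext _ _ fun s => congrArg (· s) (map_add (iterDeriv 1) γ δ)
  map_smul' r γ := DFunLike.ext _ _ fun s => congrArg (· s) (map_smul (iterDeriv 1) r γ)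
  cont := by
    refine continuous_iff_iterDeriv.2 fun k => (continuous_iterDeriv (k + 1)).congr fun γ => ?_
    ext s
    induction s using QuotientAddGroup.induction_on with
    | H x =>
      change iteratedDeriv (k + 1) γ.pull x = iteratedDeriv k (iteratedDeriv 1 γ.pull) x
      rw [iteratedDeriv_one, iteratedDeriv_succ']

theorem iterDeriv_derivative (k : ℕ) (γ : LR) :
    iterDeriv k (derivative γ) = iterDeriv (k + 1) γ := by
  ext s
  induction s using QuotientAddGroup.induction_on with
  | H x =>
    change iteratedDeriv k (iteratedDeriv 1 γ.pull) x = iteratedDeriv (k + 1) γ.pull x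
    rw [iteratedDeriv_one, iteratedDeriv_succ']

theorem hasDerivAt_iteratedDeriv_pull (k : ℕ) (γ : LR) (x : ℝ) :
    HasDerivAt (iteratedDeriv k γ.pull) (iteratedDeriv (k + 1) γ.pull x) x := by
  rw [iteratedDeriv_succ]
  exact (γ.contDiff_pull.differentiable_iteratedDeriv k (by exact_mod_cast WithTop.coe_lt_top _)
    x).hasDerivAt

theorem abs_iteratedDeriv_pull_le (k : ℕ) (γ : LR) (x : ℝ) :
    |iteratedDeriv k γ.pull x| ≤ ‖iterDeriv k γ‖ :=
  (iterDeriv k γ).norm_coe_le_norm (x : S1)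

/-- First-order Taylor estimate for a function with bounded second derivative. -/
theorem abs_sub_sub_mul_le {f f' f'' : ℝ → ℝ} {M : ℝ} (hf : ∀ x, HasDerivAt f (f' x) x)
    (hf' : ∀ x, HasDerivAt f' (f'' x) x) (hM : ∀ x, |f'' x| ≤ M) (y h : ℝ) :
    |f (y + h) - f y - h * f' y| ≤ M * |h| * |h| := by
  have hlip : ∀ z, |f' (y + z) - f' y| ≤ M * |z| := fun z => by
    simpa using convex_univ.norm_image_sub_le_of_norm_hasDerivWithin_le
      (fun x _ => (hf' x).hasDerivWithinAt) (fun x _ => hM x) (Set.mem_univ y)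
      (Set.mem_univ (y + z))
  have hM0 : 0 ≤ M := (abs_nonneg _).trans (hM 0)
  have hg : ∀ z, HasDerivAt (fun z => f (y + z) - z * f' y) (f' (y + z) - f' y) z := fun z => by
    have h := ((hf (y + z)).comp_const_add y z).sub ((hasDerivAt_id z).mul_const (f' y))
    rw [one_mul] at h
    exact h
  have := (convex_closedBall (0 : ℝ) |h|).norm_image_sub_le_of_norm_hasDerivWithin_le
    (C := M * |h|) (fun z _ => (hg z).hasDerivWithinAt)
    (fun z hz => (hlip z).trans (by
      have : |z| ≤ |h| := by simpa using hz
      gcongr)) (x := 0) (y := h) (by simp) (by simp)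
  simpa [sub_right_comm] using this

theorem norm_iterDeriv_slope_sub_le (k : ℕ) (γ : LR) (a : ℝ) {h : ℝ} (hh : h ≠ 0) :
    ‖iterDeriv k (h⁻¹ • (rotate ((a + h : ℝ) : S1) γ - rotate (a : S1) γ)
      - rotate (a : S1) (derivative γ))‖ ≤ |h| * ‖iterDeriv (k + 2) γ‖ := by
  refine (ContinuousMap.norm_le _ (by positivity)).2 fun s => ?_
  induction s using QuotientAddGroup.induction_on with
  | H x =>
    simp only [map_sub, map_smul, iterDeriv_rotate, iterDeriv_derivative]
    change |h⁻¹ * (iteratedDeriv k γ.pull (x + (a + h)) - iteratedDeriv k γ.pull (x + a))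
      - iteratedDeriv (k + 1) γ.pull (x + a)| ≤ _
    have hT := abs_sub_sub_mul_le (hasDerivAt_iteratedDeriv_pull k γ)
      (hasDerivAt_iteratedDeriv_pull (k + 1) γ) (abs_iteratedDeriv_pull_le (k + 2) γ) (x + a) h
    rw [← add_assoc]
    set u := iteratedDeriv k γ.pull (x + a + h) - iteratedDeriv k γ.pull (x + a)
    set v := iteratedDeriv (k + 1) γ.pull (x + a)
    have hfac : u - h * v = h * (h⁻¹ * u - v) := by field_simp
    rw [hfac, abs_mul] at hT
    have hpos : 0 < |h| := abs_pos.2 hh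
    nlinarith

/-! ### Smoothness of the rotations -/

/-- In `L_b(L ℝ)`, the derivative of `a ↦ R_a` is `R_a ∘ derivative`. -/
theorem hasCurveDerivAt_representation (a : ℝ) :
    HasCurveDerivAt (fun b : ℝ => representation (b : S1))
      ((representation (a : S1)).comp derivative) a := by
  refine tendsto_sub_nhds_zero_iff.1 (tendsto_clm_nhds_zero fun S hS k => ?_)
  obtain ⟨C, hC⟩ := exists_norm_iterDeriv_le hS (k + 2)
  have hlim : Tendsto (fun p : ℝ × LR => |p.1| * C) ((𝓝[≠] 0) ×ˢ 𝓟 S) (𝓝 0) := by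
    have h0 : Tendsto (fun h : ℝ => |h| * C) (𝓝[≠] 0) (𝓝 0) := by
      have : Continuous fun h : ℝ => |h| * C := by fun_prop
      simpa using (this.tendsto 0).mono_left nhdsWithin_le_nhds
    exact h0.comp tendsto_fst
  refine squeeze_zero_norm' ?_ hlim
  refine eventually_prod_principal_iff.2 ?_
  filter_upwards [self_mem_nhdsWithin] with h hh γ hγ
  exact (norm_iterDeriv_slope_sub_le k γ a hh).trans
    (mul_le_mul_of_nonneg_left (hC γ hγ) (abs_nonneg h))

theorem representation_lift_mem_smoothCurves {θ : ℝ → ℝ} (hθ : ContDiff ℝ ∞ θ) :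
    (fun t => representation (θ t : S1)) ∈ smoothCurves (LR →L[ℝ] LR) := by
  let P : (LR →L[ℝ] LR) →L[ℝ] (LR →L[ℝ] LR) := derivative.precomp LR
  have h := smul_mem_smoothCurves_of_hasCurveDerivAt_succ (f := fun _ => 1) (g := deriv θ)
    (u := fun n t => (P ^ n) (representation (θ t : S1)))
    (contDiff_infty_iff_deriv.1 hθ).2 (fun n t => ?_) contDiff_const 0
  · simpa using h
  · have h := ((hasCurveDerivAt_representation (θ t)).comp
      ((hθ.differentiable (by simp)) t).hasDerivAt).clm_comp (P ^ n)
    rw [map_smul] at h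
    rw [pow_succ]
    exact h

/-- Product rule for `t ↦ R_{θ(t)} c(t)`. -/
theorem hasCurveDerivAt_rotate {θ : ℝ → ℝ} {θ' t : ℝ} {c : ℝ → LR} {v : LR}
    (hθ : HasDerivAt θ θ' t) (hc : HasCurveDerivAt c v t) :
    HasCurveDerivAt (fun s => rotate (θ s : S1) (c s))
      (rotate (θ t : S1) (v + θ' • derivative (c t))) t := by
  have h1 : Tendsto (fun h => rotate (θ (t + h) : S1) (h⁻¹ • (c (t + h) - c t))) (𝓝[≠] 0)
      (𝓝 (rotate (θ t : S1) v)) := by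
    have hθt := (hasCurveDerivAt_real_iff.2 hθ).tendsto
    exact (continuous_actionMap.tendsto ((θ t : S1), v)).comp
      ((((AddCircle.continuous_mk' 1).tendsto _).comp hθt).prodMk_nhds hc)
  have h2 : HasCurveDerivAt (fun s => rotate (θ s : S1) (c t))
      (θ' • rotate (θ t : S1) (derivative (c t))) t := by
    have h := (hasCurveDerivAt_representation (θ t)).comp hθ
    exact ((continuous_eval_const (c t)).tendsto _).comp h
  have hsum := h1.add h2
  have hval : rotate (θ t : S1) v + θ' • rotate (θ t : S1) (derivative (c t)) =
      rotate (θ t : S1) (v + θ' • derivative (c t)) := rfl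
  rw [hval] at hsum
  refine hsum.congr fun h => ?_
  change representation _ _ + _ = h⁻¹ • (representation _ _ - _)
  rw [map_smul, map_sub, ← smul_add]
  exact congrArg _ (sub_add_sub_cancel _ _ _)

theorem rotate_lift_mem_smoothCurves {θ : ℝ → ℝ} (hθ : ContDiff ℝ ∞ θ) {c : ℝ → LR}
    (hc : c ∈ smoothCurves LR) : (fun t => rotate (θ t : S1) (c t)) ∈ smoothCurves LR := by
  refine mem_smoothCurves_of_forall_exists_deriv
    (S := {b | ∃ c ∈ smoothCurves LR, b = fun t => rotate (θ t : S1) (c t)}) ?_ ⟨c, hc, rfl⟩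
  rintro _ ⟨c, hc, rfl⟩
  obtain ⟨c', hc', hder⟩ := exists_deriv_of_mem_smoothCurves hc
  have hθ' : ContDiff ℝ ∞ (deriv θ) := (contDiff_infty_iff_deriv.1 hθ).2
  exact ⟨_, ⟨fun t => c' t + deriv θ t • derivative (c t),
    add_mem_smoothCurves hc' (smul_mem_smoothCurves hθ' (clm_comp_mem_smoothCurves derivative hc)),
    rfl⟩, fun t =>
      hasCurveDerivAt_rotate ((hθ.differentiable (by simp)) t).hasDerivAt (hder t)⟩

end LR

end LoopSpace

end

theorem mainTheorem11 :
    LoopSpace.ConvenientSmooth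
        (LoopSpace.smoothCurvesProd LoopSpace.smoothCurvesCircle
          (LoopSpace.smoothCurves LoopSpace.LR))
        (LoopSpace.smoothCurves LoopSpace.LR)
        LoopSpace.LR.actionMap ∧
      LoopSpace.ConvenientSmooth
        LoopSpace.smoothCurvesCircle
        (LoopSpace.smoothCurves (LoopSpace.LR →L[ℝ] LoopSpace.LR))
        LoopSpace.LR.representation := by
  refine ⟨fun c ⟨h1, h2⟩ => ?_, fun c hc => ?_⟩
  · obtain ⟨θ, hθ, h⟩ := LoopSpace.exists_contDiff_lift h1
    have h' : (fun t => LoopSpace.LR.actionMap (c t)) =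
        fun t => LoopSpace.LR.rotate (θ t : LoopSpace.S1) (c t).2 :=
      funext fun t => congrArg (LoopSpace.LR.rotate · (c t).2) (congrFun h t)
    rw [h']
    exact LoopSpace.LR.rotate_lift_mem_smoothCurves hθ h2
  · obtain ⟨θ, hθ, rfl⟩ := LoopSpace.exists_contDiff_lift hc
    exact LoopSpace.LR.representation_lift_mem_smoothCurves hθ
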